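/- Let $(X,\|\cdot\|_X)$ be a Banach space over $\mathbb K\in\{\mathbb R,\mathbb C\}$ and $\tau_X$ a Hausdorff locally convex topology on $X$ such that $(X,\|\cdot\|_X,\tau_X)$ is a Saks space, i.e. $\tau_X$ is coarser than the norm topology and $(X,\tau_X)'$ is norming: $\|x\|_X=\sup\{|x'(x)| : x'\in (X,\tau_X)',\ \|x'\|_{X'}\le 1\}$ for all $x\in X$. Let $\gamma_X$ be the mixed topology, i.e. the finest linear topology on $X$ that coincides with $\tau_X$ on $\|\cdot\|_X$-bounded sets and satisfies $\tau_X\subseteq\gamma_X\subseteq\tau_{\|\cdot\|_X}$, where $\tau_{\|\cdot\|_X}$ is the norm topology. Assume that $(X,\gamma_X)$ is sequentially complete and C-sequential (every convex sequentially open subset of $(X,\gamma_X)$ is open). Let $(S_t)_{t\ge 0}$ be a locally $\tau_X$-bi-continuous semigroup on $X$: each $S_t$ is a bounded linear operator on $(X,\|\cdot\|_X)$, $S_0=I$, $S_{t+s}=S_tS_s$ for $s,t\ge 0$; there are $M\ge 1$ and $\omega\in\mathbb R$ with $\|S_t\|\le M e^{\omega t}$ for all $t\ge 0$; for every $x\in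 X$ the map $[0,\infty)\ni t\mapsto S_tx\in(X,\tau_X)$ is continuous; and whenever $(x_n)$ is a $\|\cdot\|_X$-bounded sequence with $\tau_X$-limit $x\in X$, then $S_t(x_n-x)\to 0$ in $\tau_X$ uniformly for $t\in[0,T]$, for every $T\geq 0$. Let $X^\circ$ be the space of all $x'\in X'$ (the norm dual) that are sequentially $\tau_X$-continuous on $\|\cdot\|_X$-bounded sets, with the norm of $X'$. Then for all $t\ge 0$ and $x^\circ\in X^\circ$ one has $S_t'x^\circ=x^\circ\circ S_t\in X^\circ$; the maps $S_t^\circ x^\circ:=S_t'x^\circ$ are bounded linear operators on $X^\circ$; $S_0^\circ=I$ and $S^\circ_{t+s}=S^\circ_tS^\circ_s$ for $s,t\ge0$; there are $M\ge1$, $\omega\in\mathbb R$ with $\|S_t^\circ\|\le Me^{\omega t}$ for all $t\ge0$; and for every $x^\circ\in X^\circ$ the map $[0,\infty)\ni t\mapsto S_t^\circ x^\circ\in X^\circ$ is continuous for the topology of uniform convergence on $\|\cdot\|_X$-compact subsets of $X$. -/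

import Mathlib

open Filter Topology Bornology
open scoped NNReal

/-- A further topology on `X`. It is wrapped in a structure so that instance search never confuses
it with the norm topology of `X`: below, every topology found by instance search (for instance the
one in `X →L[𝕜] X` or in `StrongDual 𝕜 X`) is the norm topology. -/
structure ExtraTopology (X : Type*) where
  top : TopologicalSpace X

/-- The norm topology. -/
abbrev normTopology (X : Type*) [NormedAddCommGroup X] : TopologicalSpace X :=
  UniformSpace.toTopologicalSpace

/-- A linear topology on a vector space: addition and scalar multiplication are continuous. -/
structure IsLinearTopologyOn (𝕜 : Type*) [RCLike 𝕜] {X : Type*} [AddCommGroup X] [Module 𝕜 X]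
    (σ : ExtraTopology X) : Prop where
  add : @IsTopologicalAddGroup X σ.top _
  smul : @ContinuousSMul 𝕜 X _ _ σ.top

/-- Two topologies coincide on every norm-bounded set. -/
def AgreeOnBounded {X : Type*} [NormedAddCommGroup X] (σ τ : ExtraTopology X) : Prop :=
  ∀ B : Set X, IsBounded B →
    TopologicalSpace.induced (Subtype.val : B → X) σ.top =
      TopologicalSpace.induced (Subtype.val : B → X) τ.top

/-- `(X, ‖·‖, τ)` is a Saks space: `X` is a Banach space, `τ` is a Hausdorff locally convex
topology coarser than the norm topology, and the `τ`-continuous functionals are norming.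
(In Mathlib's order on topologies `σ ≤ τ` means that `σ` is finer than `τ`.) -/
structure IsSaksSpace (𝕜 : Type*) [RCLike 𝕜] (X : Type*) [NormedAddCommGroup X]
    [NormedSpace 𝕜 X] [Module ℝ X] (τ : ExtraTopology X) : Prop where
  complete : CompleteSpace X
  linear : IsLinearTopologyOn 𝕜 τ
  hausdorff : @T2Space X τ.top
  locallyConvex : @LocallyConvexSpace ℝ X _ _ _ _ τ.top
  coarser : normTopology X ≤ τ.top
  norming : ∀ x : X, IsLUB
    {r : ℝ | ∃ f : StrongDual 𝕜 X, Continuous[τ.top, inferInstance] f ∧ ‖f‖ ≤ 1 ∧ r = ‖f x‖} ‖x‖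

/-- The linear topologies that lie between `τ` and the norm topology and coincide with `τ` on
norm-bounded sets. -/
def mixedCandidates (𝕜 : Type*) [RCLike 𝕜] {X : Type*} [NormedAddCommGroup X]
    [NormedSpace 𝕜 X] (τ : ExtraTopology X) : Set (TopologicalSpace X) :=
  {σ | IsLinearTopologyOn 𝕜 ⟨σ⟩ ∧ AgreeOnBounded ⟨σ⟩ τ ∧ normTopology X ≤ σ ∧ σ ≤ τ.top}

/-- The mixed topology `γ(‖·‖, τ)`: the finest element of `mixedCandidates`
(see `isLeast_mixedTopology`). -/
def mixedTopology (𝕜 : Type*) [RCLike 𝕜] {X : Type*} [NormedAddCommGroup X]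
    [NormedSpace 𝕜 X] (τ : ExtraTopology X) : ExtraTopology X :=
  ⟨sInf (mixedCandidates 𝕜 τ)⟩

/-- On a Saks space `mixedTopology` really is the finest among its candidates. -/
theorem isLeast_mixedTopology (𝕜 : Type*) [RCLike 𝕜] {X : Type*} [NormedAddCommGroup X]
    [NormedSpace 𝕜 X] [Module ℝ X] (τ : ExtraTopology X) (hτ : IsSaksSpace 𝕜 X τ) :
    IsLeast (mixedCandidates 𝕜 τ) (mixedTopology 𝕜 τ).top := by
  have hmem : τ.top ∈ mixedCandidates 𝕜 τ := ⟨hτ.linear, fun _ _ => rfl, hτ.coarser, le_rfl⟩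
  refine ⟨⟨⟨?_, ?_⟩, ?_, ?_, sInf_le hmem⟩, fun σ hσ => sInf_le hσ⟩
  · exact topologicalAddGroup_sInf fun σ hσ => hσ.1.add
  · exact continuousSMul_sInf fun σ hσ => hσ.1.smul
  · intro B hB
    apply le_antisymm
    · exact induced_mono (sInf_le hmem)
    · change _ ≤ TopologicalSpace.induced _ (sInf _)
      rw [sInf_eq_iInf', induced_iInf]
      exact le_iInf fun σ => (σ.2.2.1 B hB).ge
  · exact le_sInf fun σ hσ => hσ.2.2.1

/-- Every Cauchy sequence of the topological group `(X, σ)` converges. -/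
def SeqCompleteFor {X : Type*} [AddCommGroup X] (σ : ExtraTopology X) : Prop :=
  ∀ u : ℕ → X, (∀ V ∈ @nhds X σ.top 0, ∃ N : ℕ, ∀ m ≥ N, ∀ n ≥ N, u m - u n ∈ V) →
    ∃ x : X, Tendsto u atTop (@nhds X σ.top x)

/-- `s` is sequentially open: a sequence that converges to a point of `s` is eventually in `s`. -/
def SeqOpenFor {X : Type*} (σ : ExtraTopology X) (s : Set X) : Prop :=
  ∀ x ∈ s, ∀ u : ℕ → X, Tendsto u atTop (@nhds X σ.top x) → ∀ᶠ n in atTop, u n ∈ s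

/-- `(X, σ)` is C-sequential: every convex sequentially open set is open. -/
def CSequentialFor {X : Type*} [AddCommGroup X] [Module ℝ X] (σ : ExtraTopology X) : Prop :=
  ∀ s : Set X, Convex ℝ s → SeqOpenFor σ s → IsOpen[σ.top] s

/-- A one-parameter semigroup of bounded linear operators. -/
structure IsOperatorSemigroup (𝕜 E : Type*) [RCLike 𝕜] [NormedAddCommGroup E]
    [NormedSpace 𝕜 E] (S : ℝ≥0 → E →L[𝕜] E) : Prop where
  zero : S 0 = ContinuousLinearMap.id 𝕜 E
  add : ∀ s t : ℝ≥0, S (t + s) = (S t).comp (S s)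

/-- Exponential boundedness: `‖S t‖ ≤ M * exp (ω * t)` for all `t ≥ 0`. -/
def IsExpBounded (𝕜 E : Type*) [RCLike 𝕜] [NormedAddCommGroup E]
    [NormedSpace 𝕜 E] (S : ℝ≥0 → E →L[𝕜] E) : Prop :=
  ∃ M : ℝ, 1 ≤ M ∧ ∃ ω : ℝ, ∀ t : ℝ≥0, ‖S t‖ ≤ M * Real.exp (ω * t)

/-- Strong continuity on `[0, ∞)` with respect to the topology `σ`. -/
def IsStronglyContinuous (𝕜 E : Type*) [RCLike 𝕜] [NormedAddCommGroup E]
    [NormedSpace 𝕜 E] (σ : ExtraTopology E) (S : ℝ≥0 → E →L[𝕜] E) : Prop :=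
  ∀ x : E, Continuous[inferInstance, σ.top] fun t : ℝ≥0 => S t x

/-- Local bi-equicontinuity: if `(u n)` is norm-bounded and `τ`-converges to `x`, then
`S t (u n - x) → 0` in `τ`, uniformly for `t` in `[0, T]`, for every `T`. -/
def IsLocallyBiEquicontinuous (𝕜 X : Type*) [RCLike 𝕜] [NormedAddCommGroup X]
    [NormedSpace 𝕜 X]
    (τ : ExtraTopology X) (S : ℝ≥0 → X →L[𝕜] X) : Prop :=
  ∀ (u : ℕ → X) (x : X), IsBounded (Set.range u) → Tendsto u atTop (@nhds X τ.top x) →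
    ∀ T : ℝ≥0, ∀ V ∈ @nhds X τ.top 0, ∀ᶠ n in atTop, ∀ t ≤ T, S t (u n - x) ∈ V

/-- A locally `τ`-bi-continuous semigroup. -/
structure IsLocallyBiContinuousSemigroup (𝕜 X : Type*) [RCLike 𝕜] [NormedAddCommGroup X]
    [NormedSpace 𝕜 X] (τ : ExtraTopology X) (S : ℝ≥0 → X →L[𝕜] X) : Prop where
  semigroup : IsOperatorSemigroup 𝕜 X S
  expBounded : IsExpBounded 𝕜 X S
  stronglyContinuous : IsStronglyContinuous 𝕜 X τ S
  locallyBiEquicontinuous : IsLocallyBiEquicontinuous 𝕜 X τ S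

/-- The space `X°` of the functionals in the norm dual that are sequentially `τ`-continuous on
norm-bounded sets; it carries the norm of the dual space. -/
def circDual (𝕜 : Type*) [RCLike 𝕜] {X : Type*} [NormedAddCommGroup X] [NormedSpace 𝕜 X]
    (τ : ExtraTopology X) : Submodule 𝕜 (StrongDual 𝕜 X) where
  carrier := {f | ∀ B : Set X, IsBounded B → ∀ u : ℕ → X, (∀ n, u n ∈ B) → ∀ x ∈ B,
    Tendsto u atTop (@nhds X τ.top x) → Tendsto (fun n => f (u n)) atTop (𝓝 (f x))}
  zero_mem' := fun _ _ _ _ _ _ _ => by simp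
  add_mem' := fun hf hg B hB u hu x hx h => (hf B hB u hu x hx h).add (hg B hB u hu x hx h)
  smul_mem' := fun c _ hf B hB u hu x hx h => (hf B hB u hu x hx h).const_smul c

/-- The topology on `X°` of uniform convergence on the norm-compact subsets of `X`, induced from
the topology of compact convergence on the dual space. -/
def compactConvergenceTopology (𝕜 : Type*) [RCLike 𝕜] {X : Type*} [NormedAddCommGroup X]
    [NormedSpace 𝕜 X] (τ : ExtraTopology X) : ExtraTopology (circDual 𝕜 τ) :=
  ⟨TopologicalSpace.induced
    (fun f => (show CompactConvergenceCLM (RingHom.id 𝕜) X 𝕜 from (f : StrongDual 𝕜 X)))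
    inferInstance⟩

/-! Local bi-equicontinuity at a fixed time makes `S t` preserve `τ`-limits of norm-bounded
sequences, so composing with `S t` keeps a functional in `X°`; the semigroup law and the exponential
bound then pass over from `S`. For continuity, orbits are `τ`-continuous and locally norm-bounded,
so `t ↦ f (S t x)` is continuous for `f ∈ X°` (`continuous_circDual_apply`). The functionals `f ∘ S
s` with `s` near `t` are norm-bounded, hence equicontinuous, which upgrades pointwise convergence to
uniform convergence on compact sets (`StrongDual.tendstoUniformlyOn_of_norm_le`). -/

theorem IsExpBounded.exists_norm_le {𝕜 E : Type*} [RCLike 𝕜] [NormedAddCommGroup E]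
    [NormedSpace 𝕜 E] {S : ℝ≥0 → E →L[𝕜] E} (hS : IsExpBounded 𝕜 E S) (T : ℝ≥0) :
    ∃ C : ℝ, 0 ≤ C ∧ ∀ t ≤ T, ‖S t‖ ≤ C := by
  obtain ⟨M, hM, ω, h⟩ := hS
  -- `|ω|` makes the exponent monotone in time even when `ω` is negative.
  refine ⟨M * Real.exp (|ω| * T), by positivity, fun t ht => (h t).trans ?_⟩
  have ht' : (t : ℝ) ≤ T := by exact_mod_cast ht
  gcongr
  exact le_abs_self ω

theorem tendsto_apply_of_mem_circDual {𝕜 X : Type*} [RCLike 𝕜] [NormedAddCommGroup X]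
    [NormedSpace 𝕜 X] {τ : ExtraTopology X} {f : StrongDual 𝕜 X} (hf : f ∈ circDual 𝕜 τ)
    {u : ℕ → X} {x : X} (hu : IsBounded (Set.range u))
    (hx : Tendsto u atTop (@nhds X τ.top x)) :
    Tendsto (fun n => f (u n)) atTop (𝓝 (f x)) :=
  -- The bounded set in the definition of `X°` must contain the limit too.
  hf (insert x (Set.range u)) (isBounded_insert.mpr hu) u
    (fun n => Set.mem_insert_of_mem _ ⟨n, rfl⟩) x (Set.mem_insert _ _) hx

namespace IsLocallyBiContinuousSemigroup

variable {𝕜 X : Type*} [RCLike 𝕜] [NormedAddCommGroup X] [NormedSpace 𝕜 X]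
  {τ : ExtraTopology X} {S : ℝ≥0 → X →L[𝕜] X}

theorem tendsto_apply (hS : IsLocallyBiContinuousSemigroup 𝕜 X τ S)
    (hτ : IsLinearTopologyOn 𝕜 τ) (t : ℝ≥0) {u : ℕ → X} {x : X}
    (hu : IsBounded (Set.range u)) (hx : Tendsto u atTop (@nhds X τ.top x)) :
    Tendsto (fun n => S t (u n)) atTop (@nhds X τ.top (S t x)) := by
  let _ := τ.top
  have := hτ.add
  have h : Tendsto (fun n => S t (u n - x)) atTop (@nhds X τ.top 0) := fun V hV =>
    (hS.locallyBiEquicontinuous u x hu hx t V hV).mono fun n hn => hn t le_rfl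
  simpa using @Filter.Tendsto.add_const X _ _ _ _ _ _ _ (S t x) h

theorem comp_mem_circDual (hS : IsLocallyBiContinuousSemigroup 𝕜 X τ S)
    (hτ : IsLinearTopologyOn 𝕜 τ) (t : ℝ≥0) {f : StrongDual 𝕜 X} (hf : f ∈ circDual 𝕜 τ) :
    f.comp (S t) ∈ circDual 𝕜 τ := by
  intro B hB u hu x _ hx
  have hu' : IsBounded (Set.range u) := hB.subset (Set.range_subset_iff.mpr hu)
  refine tendsto_apply_of_mem_circDual hf ?_ (hS.tendsto_apply hτ t hu' hx)
  exact ((S t).lipschitz.isBounded_image hu').subset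
    (Set.range_subset_iff.mpr fun n => ⟨u n, ⟨n, rfl⟩, rfl⟩)

/-- The operator `f ↦ f ∘ S t` on `X°`, as a linear map. -/
def circLinearMap (hS : IsLocallyBiContinuousSemigroup 𝕜 X τ S)
    (hτ : IsLinearTopologyOn 𝕜 τ) (t : ℝ≥0) : circDual 𝕜 τ →ₗ[𝕜] circDual 𝕜 τ where
  toFun f := ⟨(f : StrongDual 𝕜 X).comp (S t), hS.comp_mem_circDual hτ t f.2⟩
  map_add' _ _ := rfl
  map_smul' _ _ := rfl

theorem norm_circLinearMap_le (hS : IsLocallyBiContinuousSemigroup 𝕜 X τ S)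
    (hτ : IsLinearTopologyOn 𝕜 τ) (t : ℝ≥0) (f : circDual 𝕜 τ) :
    ‖hS.circLinearMap hτ t f‖ ≤ ‖S t‖ * ‖f‖ := by
  rw [mul_comm]
  exact ContinuousLinearMap.opNorm_comp_le (f : StrongDual 𝕜 X) (S t)

/-- The operator `f ↦ f ∘ S t` on `X°`. -/
noncomputable def circ (hS : IsLocallyBiContinuousSemigroup 𝕜 X τ S)
    (hτ : IsLinearTopologyOn 𝕜 τ) (t : ℝ≥0) : circDual 𝕜 τ →L[𝕜] circDual 𝕜 τ where
  toLinearMap := hS.circLinearMap hτ t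
  cont := AddMonoidHomClass.continuous_of_bound (hS.circLinearMap hτ t) ‖S t‖
    (hS.norm_circLinearMap_le hτ t)

theorem coe_circ (hS : IsLocallyBiContinuousSemigroup 𝕜 X τ S)
    (hτ : IsLinearTopologyOn 𝕜 τ) (t : ℝ≥0) (f : circDual 𝕜 τ) :
    (hS.circ hτ t f : StrongDual 𝕜 X) = (f : StrongDual 𝕜 X).comp (S t) := rfl

theorem isOperatorSemigroup_circ (hS : IsLocallyBiContinuousSemigroup 𝕜 X τ S)
    (hτ : IsLinearTopologyOn 𝕜 τ) : IsOperatorSemigroup 𝕜 (circDual 𝕜 τ) (hS.circ hτ) where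
  zero := by
    ext f x
    simp [coe_circ, hS.semigroup.zero]
  add s t := by
    ext f x
    -- Precomposition reverses the order of the factors; commutativity of time addition repairs
    -- this.
    simp [coe_circ, add_comm t s, hS.semigroup.add t s]

theorem isExpBounded_circ (hS : IsLocallyBiContinuousSemigroup 𝕜 X τ S)
    (hτ : IsLinearTopologyOn 𝕜 τ) : IsExpBounded 𝕜 (circDual 𝕜 τ) (hS.circ hτ) := by
  obtain ⟨M, hM, ω, h⟩ := hS.expBounded
  exact ⟨M, hM, ω, fun t => (ContinuousLinearMap.opNorm_le_bound _ (norm_nonneg (S t))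
    (hS.norm_circLinearMap_le hτ t)).trans (h t)⟩

/-- Sequences of times suffice because `ℝ≥0` is metrizable, and this matches the purely sequential
continuity of `f`. -/
theorem continuous_circDual_apply (hS : IsLocallyBiContinuousSemigroup 𝕜 X τ S)
    {f : StrongDual 𝕜 X} (hf : f ∈ circDual 𝕜 τ) (x : X) :
    Continuous fun t => f (S t x) := by
  rw [continuous_iff_seqContinuous]
  intro s t hs
  refine tendsto_apply_of_mem_circDual hf ?_
    ((@Continuous.tendsto _ _ _ τ.top _ (hS.stronglyContinuous x) t).comp hs)
  -- A convergent sequence of times is bounded, so the orbit stays norm-bounded along it.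
  obtain ⟨T, hT⟩ := hs.bddAbove_range
  obtain ⟨C, -, hC⟩ := hS.expBounded.exists_norm_le T
  refine isBounded_iff_forall_norm_le.mpr ⟨C * ‖x‖, ?_⟩
  rintro _ ⟨n, rfl⟩
  exact (S (s n)).le_of_opNorm_le (hC _ (hT ⟨n, rfl⟩)) x

end IsLocallyBiContinuousSemigroup

/-- A pointwise convergent family of functionals that is eventually norm-bounded converges
uniformly on compact sets. -/
theorem StrongDual.tendstoUniformlyOn_of_norm_le {𝕜 X ι : Type*} [RCLike 𝕜]
    [NormedAddCommGroup X] [NormedSpace 𝕜 X] {l : Filter ι} {F : ι → StrongDual 𝕜 X}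
    {g : StrongDual 𝕜 X} {C : ℝ} (hF : ∀ᶠ i in l, ‖F i‖ ≤ C) (hg : ‖g‖ ≤ C)
    (h : ∀ x, Tendsto (fun i => F i x) l (𝓝 (g x))) {K : Set X} (hK : IsCompact K) :
    TendstoUniformlyOn (fun i x => F i x) g l K := by
  rw [← tendstoLocallyUniformlyOn_iff_tendstoUniformlyOn_of_compact hK,
    Metric.tendstoLocallyUniformlyOn_iff]
  intro ε hε x _
  have hC : 0 ≤ C := (norm_nonneg g).trans hg
  -- `C + 1` avoids division by zero; the `3` serves the three-term estimate through `g x` and `F i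
  -- x`.
  have hδ : 0 < ε / (3 * (C + 1)) := by positivity
  refine ⟨Metric.ball x (ε / (3 * (C + 1))), mem_nhdsWithin_of_mem_nhds
    (Metric.ball_mem_nhds x hδ), ?_⟩
  have key : ∀ {φ : StrongDual 𝕜 X}, ‖φ‖ ≤ C → ∀ y ∈ Metric.ball x (ε / (3 * (C + 1))),
      dist (φ y) (φ x) < ε / 3 := by
    intro φ hφ y hy
    rw [Metric.mem_ball, dist_eq_norm] at hy
    rw [dist_eq_norm, ← map_sub]
    calc ‖φ (y - x)‖ ≤ C * ‖y - x‖ := φ.le_of_opNorm_le hφ _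
      _ ≤ (C + 1) * ‖y - x‖ := by gcongr; linarith
      _ < (C + 1) * (ε / (3 * (C + 1))) := by gcongr
      _ = ε / 3 := by field_simp
  filter_upwards [hF, Metric.tendsto_nhds.mp (h x) (ε / 3) (by positivity)] with i hi hix y hy
  have h₁ := key hg y hy
  have h₂ := key hi y hy
  rw [dist_comm] at hix h₂
  have h₃ := dist_triangle4 (g y) (g x) (F i x) (F i y)
  linarith

theorem IsLocallyBiContinuousSemigroup.isStronglyContinuous_circ {𝕜 X : Type*} [RCLike 𝕜]
    [NormedAddCommGroup X] [NormedSpace 𝕜 X] {τ : ExtraTopology X} {S : ℝ≥0 → X →L[𝕜] X}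
    (hS : IsLocallyBiContinuousSemigroup 𝕜 X τ S) (hτ : IsLinearTopologyOn 𝕜 τ) :
    IsStronglyContinuous 𝕜 (circDual 𝕜 τ) (compactConvergenceTopology 𝕜 τ) (hS.circ hτ) := by
  intro f
  refine continuous_induced_rng.mpr (continuous_iff_continuousAt.mpr fun t => ?_)
  refine (UniformConvergenceCLM.tendsto_iff_tendstoUniformlyOn _ _ _).mpr fun K hK => ?_
  -- Times below `t + 1` form a neighbourhood of `t`.
  obtain ⟨C, hC0, hC⟩ := hS.expBounded.exists_norm_le (t + 1)
  have hbound : ∀ s ≤ t + 1, ‖(f : StrongDual 𝕜 X).comp (S s)‖ ≤ ‖(f : StrongDual 𝕜 X)‖ * C :=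
    fun s hs => (ContinuousLinearMap.opNorm_comp_le _ _).trans (by gcongr; exact hC s hs)
  exact StrongDual.tendstoUniformlyOn_of_norm_le
    (F := fun s => (f : StrongDual 𝕜 X).comp (S s)) (g := (f : StrongDual 𝕜 X).comp (S t))
    ((eventually_le_nhds (lt_add_one t)).mono hbound) (hbound t (le_add_of_nonneg_right zero_le_one))
    (fun x => (hS.continuous_circDual_apply f.2 x).tendsto t) hK

theorem mainTheorem8 {𝕜 : Type*} [RCLike 𝕜] {X : Type*} [NormedAddCommGroup X] [NormedSpace 𝕜 X]
    [Module ℝ X] [IsScalarTower ℝ 𝕜 X] (τ : ExtraTopology X)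
    (hSaks : IsSaksSpace 𝕜 X τ)
    (hComplete : SeqCompleteFor (mixedTopology 𝕜 τ))
    (hCseq : CSequentialFor (mixedTopology 𝕜 τ))
    (S : ℝ≥0 → X →L[𝕜] X) (hS : IsLocallyBiContinuousSemigroup 𝕜 X τ S) :
    ∃ Scirc : ℝ≥0 → circDual 𝕜 τ →L[𝕜] circDual 𝕜 τ,
      (∀ (t : ℝ≥0) (f : circDual 𝕜 τ),
        (Scirc t f : StrongDual 𝕜 X) = (f : StrongDual 𝕜 X).comp (S t)) ∧
      IsOperatorSemigroup 𝕜 (circDual 𝕜 τ) Scirc ∧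
      IsExpBounded 𝕜 (circDual 𝕜 τ) Scirc ∧
      IsStronglyContinuous 𝕜 (circDual 𝕜 τ) (compactConvergenceTopology 𝕜 τ) Scirc :=
  ⟨hS.circ hSaks.linear, hS.coe_circ hSaks.linear, hS.isOperatorSemigroup_circ hSaks.linear,
    hS.isExpBounded_circ hSaks.linear, hS.isStronglyContinuous_circ hSaks.linear⟩
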